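/- Assume the Continuum Hypothesis. Then there exist a countable (regular Hausdorff) topological group $G$ and a countable family $\Xi$ of nowhere dense subsets of $G$ such that $G$ is a sequential space, $G$ is not a $k_\omega$-space, and for every convergent sequence $S$ in $G$ there is a $\xi\in\Xi$ that contains all terms of $S$. Here a space $X$ is sequential if every set $A\subseteq X$ that contains the limits of all convergent sequences of points of $A$ is closed, and $X$ is a $k_\omega$-space if there are compact subsets $K_n\subseteq X$, $n\in\omega$, such that a set $U\subseteq X$ is open if and only if each $U\cap K_n$ is relatively open in $K_n$. -/

import Mathlib

/-- A topological space `X` is a `k_ω`-space if there are countably many compact subsets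
`K 0, K 1, …` of `X` such that a set `U ⊆ X` is open if and only if every `U ∩ K n` is
relatively open in `K n`. -/
def IsKOmegaSpace (X : Type*) [TopologicalSpace X] : Prop :=
  ∃ K : ℕ → Set X, (∀ n, IsCompact (K n)) ∧
    ∀ U : Set X, IsOpen U ↔ ∀ n, IsOpen ((Subtype.val : K n → X) ⁻¹' U)

open Filter Set Topology
open scoped Pointwise

/-! Take two copies of ℤ^(ω) with pointwise convergence; let H be the first summand and ℓ(x) the
support size of the second coordinate. The topology is refined along ω₁: CH lists all pairs (A, K)
so that each stage has countably many predecessors. A stage adds a null sequence in H, avoiding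
every K n if none is yet a neighborhood of 0 in H, and a first countable group topology that keeps
the sequences so far null and makes A a neighborhood of 0 if A contains 0 and is relatively open on
the compacta they generate (`exists_addGroupTopology_mem_nhds`).

In the common refinement these compacta determine the neighborhoods of 0. They are metrizable, so G
is sequential; ℓ is bounded on each, hence along every convergent sequence, while the sets ℓ ≤ n are
nowhere dense. By Baire no compact set is a neighborhood of 0 in H, so some null sequence escapes
any given countable family of compacta, and G is not k_ω. -/

/-- Well-founded recursion with an existential step. -/
theorem exists_forall_of_wellFoundedLT {I T : Type*} [LT I] [WellFoundedLT I]
    (Φ : ∀ i : I, (∀ j, j < i → T) → T → Prop) (hΦ : ∀ i g, ∃ x, Φ i g x) :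
    ∃ f : I → T, ∀ i, Φ i (fun j _ => f j) (f i) := by
  choose F hF using hΦ
  refine ⟨(wellFounded_lt (α := I)).fix F, fun i => ?_⟩
  have := hF i (fun j _ => (wellFounded_lt (α := I)).fix F j)
  rwa [← (wellFounded_lt (α := I)).fix_eq F i] at this

theorem Filter.exists_seq_tendsto_forall_notMem {X : Type*} (F : Filter X)
    [F.IsCountablyGenerated] (K : ℕ → Set X) (hK : ∀ n, K n ∉ F) :
    ∃ s : ℕ → X, Tendsto s atTop F ∧ ∀ n, s n ∉ K n := by
  obtain ⟨B, hB⟩ := F.exists_antitone_basis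
  have : ∀ n, ∃ x ∈ B n, x ∉ K n := fun n =>
    not_subset.1 fun h => hK n (mem_of_superset (hB.mem n) h)
  choose s hs hsK using this
  exact ⟨s, hB.tendsto hs, hsK⟩

/-! ### Relative openness and generated compacta -/

/-- On a compact set, a coarser Hausdorff topology induces the same neighborhoods. -/
theorem IsCompact.nhds_inf_principal_le_of_le {X : Type*} {t σ : TopologicalSpace X}
    (hσ : @T2Space X σ) (h : t ≤ σ) {K : Set X} (hK : @IsCompact X t K) (x : X) : @nhds X σ x ⊓ 𝓟 K ≤ @nhds X t x := by
  refine @IsCompact.le_nhds_of_unique_clusterPt X t K hK _ _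
    (mem_inf_of_right (mem_principal_self K)) ?_
  intro y _ hy
  have : NeBot (@nhds X σ y ⊓ @nhds X σ x) :=
    NeBot.mono hy (inf_le_inf (_root_.nhds_mono h) inf_le_left)
  exact @eq_of_nhds_neBot X σ hσ y x this

/-- `A` is relatively open in every member of the family `𝒦`. -/
def IsRelOpenOn {X : Type*} [TopologicalSpace X] (𝒦 : Set (Set X)) (A : Set X) : Prop :=
  ∀ K ∈ 𝒦, ∀ x ∈ K, x ∈ A → A ∈ 𝓝[K] x

theorem IsRelOpenOn.exists_isOpen {X : Type*} [TopologicalSpace X] {𝒦 : Set (Set X)} {A K : Set X}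
    (hA : IsRelOpenOn 𝒦 A) (hK : K ∈ 𝒦) : ∃ O, IsOpen O ∧ A ∩ K ⊆ O ∧ O ∩ K ⊆ A := by
  refine ⟨interior (A ∪ Kᶜ), isOpen_interior, ?_, ?_⟩
  · rintro x ⟨hxA, hxK⟩
    have := hA K hK x hxK hxA
    rw [mem_interior_iff_mem_nhds]
    rw [mem_nhdsWithin_iff_exists_mem_nhds_inter] at this
    obtain ⟨u, hu, huA⟩ := this
    filter_upwards [hu] with y hy
    by_cases hyK : y ∈ K
    · exact Or.inl (huA ⟨hy, hyK⟩)
    · exact Or.inr hyK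
  · rintro x ⟨hx, hxK⟩
    exact (interior_subset hx).resolve_right fun h => h hxK

/-- The compact sets generated by a family of null sequences. -/
inductive IsSeqGenerated {G : Type*} [AddCommGroup G] (𝒮 : Set (ℕ → G)) :
    Set G → Prop
  | zero : IsSeqGenerated 𝒮 {0}
  | step (K : Set G) (s : ℕ → G) : IsSeqGenerated 𝒮 K → s ∈ 𝒮 →
      IsSeqGenerated 𝒮 ((K ∪ insert 0 (range s)) - (K ∪ insert 0 (range s)))

theorem IsSeqGenerated.mono {G : Type*} [AddCommGroup G] {𝒮 𝒯 : Set (ℕ → G)} (h : 𝒮 ⊆ 𝒯)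
    {K : Set G} (hK : IsSeqGenerated 𝒮 K) : IsSeqGenerated 𝒯 K := by
  induction hK with
  | zero => exact .zero
  | step K s _ hs ih => exact .step K s ih (h hs)

/-- A decreasing sequence of sets closed under halving defines a group topology. -/
theorem exists_addGroupTopology_of_antitone {G : Type*} [AddCommGroup G] (V : ℕ → Set G)
    (h0 : ∀ n, (0 : G) ∈ V n)
    (hV : ∀ n, V (n + 1) - V (n + 1) ⊆ V n) :
    ∃ t : AddGroupTopology G, (@nhds G t.toTopologicalSpace 0).HasBasis (fun _ : ℕ => True) V := by
  have hsucc : ∀ n, V (n + 1) ⊆ V n := fun n x hx => by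
    simpa using hV n (sub_mem_sub hx (h0 (n + 1)))
  have hanti : Antitone V := antitone_nat_of_succ_le hsucc
  have hneg : ∀ n, ∀ x ∈ V (n + 1), -x ∈ V n := fun n x hx => by
    simpa using hV n (sub_mem_sub (h0 (n + 1)) hx)
  let B : AddGroupFilterBasis G := addGroupFilterBasisOfComm (range V) (range_nonempty V)
    (by
      rintro _ _ ⟨a, rfl⟩ ⟨b, rfl⟩
      exact ⟨V (max a b), mem_range_self _,
        subset_inter (hanti (le_max_left a b)) (hanti (le_max_right a b))⟩)
    (by rintro _ ⟨n, rfl⟩; exact h0 n)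
    (by
      rintro _ ⟨n, rfl⟩
      refine ⟨V (n + 2), mem_range_self _, ?_⟩
      rintro _ ⟨x, hx, y, hy, rfl⟩
      simpa using hV n (sub_mem_sub (hsucc _ hx) (hneg _ y hy)))
    (by
      rintro _ ⟨n, rfl⟩
      exact ⟨V (n + 1), mem_range_self _, hneg n⟩)
  refine ⟨@AddGroupTopology.mk G _ B.topology B.isTopologicalAddGroup, ?_⟩
  have := B.nhds_zero_hasBasis
  refine ⟨fun U => (this.mem_iff).trans ?_⟩
  constructor
  · rintro ⟨_, ⟨n, rfl⟩, h⟩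
    exact ⟨n, trivial, h⟩
  · rintro ⟨n, -, h⟩
    exact ⟨V n, ⟨n, rfl⟩, h⟩

/-! ### A single stage: countably many null sequences -/

section TopologicalAddGroup

variable {G : Type*} [AddCommGroup G] [TopologicalSpace G] [IsTopologicalAddGroup G]

/-- The tube lemma thickens N to a compact neighborhood of N relative to C without its differences
leaving A. -/
theorem IsRelOpenOn.exists_compact_step {C D A N : Set G} (hC : IsCompact C) (hCD : C - C ⊆ D)
    (hA : IsRelOpenOn {D} A) (hN : IsCompact N) (hNC : N ⊆ C) (hNA : N - N ⊆ A) :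
    ∃ N', IsCompact N' ∧ N' ⊆ C ∧ N' - N' ⊆ A ∧ N ⊆ N' ∧
      ∃ O, IsOpen O ∧ N ⊆ O ∧ O ∩ C ⊆ N' := by
  obtain ⟨O, hO, hAO, hOA⟩ := hA.exists_isOpen (mem_singleton D)
  have hsub : N ×ˢ N ⊆ (fun p : G × G => p.1 - p.2) ⁻¹' O := by
    rintro ⟨x, y⟩ ⟨hx, hy⟩
    exact hAO ⟨hNA (sub_mem_sub hx hy), hCD (sub_mem_sub (hNC hx) (hNC hy))⟩
  obtain ⟨u, v, hu, hv, hNu, hNv, huv⟩ :=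
    generalized_tube_lemma hN hN (hO.preimage continuous_sub) hsub
  obtain ⟨W, hW, hNW, hWuv⟩ := hN.exists_isOpen_closure_subset
    ((hu.inter hv).mem_nhdsSet.2 (subset_inter hNu hNv))
  refine ⟨closure W ∩ C, hC.inter_left isClosed_closure, inter_subset_right, ?_,
    subset_inter (hNW.trans subset_closure) hNC, W, hW, hNW,
    inter_subset_inter_left _ subset_closure⟩
  rintro _ ⟨x, ⟨hx, hxC⟩, y, ⟨hy, hyC⟩, rfl⟩
  exact hOA ⟨huv (mk_mem_prod (hWuv hx).1 (hWuv hy).2), hCD (sub_mem_sub hxC hyC)⟩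

/-- For an increasing sequence of compact sets `C n` with `C n - C n ⊆ C (n + 1)`, the relatively
open sets satisfy the continuity axiom of a group topology at `0`. -/
theorem IsRelOpenOn.exists_sub_subset {C : ℕ → Set G} (hC : ∀ n, IsCompact (C n))
    (hmono : Monotone C) (h0 : C 0 = {0}) (hsub : ∀ n, C n - C n ⊆ C (n + 1)) {A : Set G}
    (hA : IsRelOpenOn (range C) A) (hA0 : (0 : G) ∈ A) :
    ∃ V, (0 : G) ∈ V ∧ V - V ⊆ A ∧ IsRelOpenOn (range C) V := by
  let P : ℕ → Set G → Prop := fun n N => IsCompact N ∧ N ⊆ C n ∧ N - N ⊆ A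
  have step : ∀ n (N : {N // P n N}), ∃ N' : {N // P (n + 1) N}, N.1 ⊆ N'.1 ∧
      ∃ O, IsOpen O ∧ N.1 ⊆ O ∧ O ∩ C (n + 1) ⊆ N'.1 := by
    rintro n ⟨N, hN, hNC, hNA⟩
    obtain ⟨N', h1, h2, h3, h4, h5⟩ := IsRelOpenOn.exists_compact_step (hC (n + 1)) (hsub (n + 1))
      (fun K hK => hA K (by rw [mem_singleton_iff.1 hK]; exact mem_range_self _)) hN
      (hNC.trans (hmono n.le_succ)) hNA
    exact ⟨⟨N', h1, h2, h3⟩, h4, h5⟩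
  choose F hF hFO using step
  let N : ∀ n, {N // P n N} := fun n => Nat.rec ⟨{0}, isCompact_singleton, h0.ge, by simpa⟩ F n
  have hN : ∀ n, (N n).1 ⊆ (N (n + 1)).1 := fun n => hF n (N n)
  have hNmono : Monotone fun n => (N n).1 := monotone_nat_of_le_succ hN
  -- Each N (n + 1) is a neighborhood of N n relative to C (n + 1), so the union is relatively open
  -- on every C n.
  refine ⟨⋃ n, (N n).1, mem_iUnion.2 ⟨0, rfl⟩, ?_, ?_⟩
  · rintro _ ⟨x, hx, y, hy, rfl⟩
    obtain ⟨a, ha⟩ := mem_iUnion.1 hx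
    obtain ⟨b, hb⟩ := mem_iUnion.1 hy
    exact (N (max a b)).2.2.2 (sub_mem_sub (hNmono (le_max_left a b) ha)
      (hNmono (le_max_right a b) hb))
  · rintro _ ⟨n, rfl⟩ x hxC hx
    obtain ⟨a, ha⟩ := mem_iUnion.1 hx
    obtain ⟨O, hO, hNO, hOC⟩ := hFO (max a n) (N (max a n))
    refine mem_nhdsWithin.2 ⟨O, hO, hNO (hNmono (le_max_left a n) ha), ?_⟩
    rintro y ⟨hyO, hyC⟩
    exact mem_iUnion.2 ⟨max a n + 1,
      hOC ⟨hyO, hmono ((le_max_right a n).trans (Nat.le_succ _)) hyC⟩⟩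

theorem IsSeqGenerated.isCompact {𝒮 : Set (ℕ → G)} (h𝒮 : ∀ s ∈ 𝒮, Tendsto s atTop (𝓝 0))
    {K : Set G} (hK : IsSeqGenerated 𝒮 K) : IsCompact K := by
  induction hK with
  | zero => exact isCompact_singleton
  | step K s _ hs ih =>
    have := ih.union (h𝒮 s hs).isCompact_insert_range
    rw [← image2_sub, ← image_prod]
    exact (this.prod this).image continuous_sub

/-- Given countably many null sequences and a set that is relatively open in the compact sets
they generate, there is a first countable group topology keeping the sequences convergent in which
the set is a neighborhood of `0`. -/
theorem exists_addGroupTopology_mem_nhds {𝒮 : Set (ℕ → G)} (hcount : 𝒮.Countable)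
    (hne : 𝒮.Nonempty) (h𝒮 : ∀ s ∈ 𝒮, Tendsto s atTop (𝓝 0)) {A : Set G} (hA0 : (0 : G) ∈ A)
    (hA : IsRelOpenOn {K | IsSeqGenerated 𝒮 K} A) :
    ∃ t : AddGroupTopology G, (@nhds G t.toTopologicalSpace 0).IsCountablyGenerated ∧
      A ∈ @nhds G t.toTopologicalSpace 0 ∧
      ∀ s ∈ 𝒮, Tendsto s atTop (@nhds G t.toTopologicalSpace 0) := by
  obtain ⟨u, rfl⟩ := hcount.exists_eq_range hne
  let C : ℕ → Set G := fun n => Nat.rec {0}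
    (fun n K => (K ∪ insert 0 (range (u n))) - (K ∪ insert 0 (range (u n)))) n
  have hCs : ∀ n, C (n + 1) = (C n ∪ insert 0 (range (u n))) - (C n ∪ insert 0 (range (u n))) :=
    fun n => rfl
  have hgen : ∀ n, IsSeqGenerated (range u) (C n) := by
    intro n
    induction n with
    | zero => exact .zero
    | succ n ih => exact .step _ _ ih (mem_range_self n)
  have hle : ∀ n, C n ∪ insert 0 (range (u n)) ⊆ C (n + 1) := fun n x hx => by
    rw [hCs]
    exact ⟨x, hx, 0, Or.inr (mem_insert _ _), sub_zero x⟩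
  have hmono : Monotone C := monotone_nat_of_le_succ fun n => subset_union_left.trans (hle n)
  have hsub : ∀ n, C n - C n ⊆ C (n + 1) := fun n =>
    sub_subset_sub subset_union_left subset_union_left
  have hstep : ∀ U : {U : Set G // (0 : G) ∈ U ∧ IsRelOpenOn (range C) U},
      ∃ V : {U : Set G // (0 : G) ∈ U ∧ IsRelOpenOn (range C) U}, V.1 - V.1 ⊆ U.1 := by
    rintro ⟨U, hU0, hU⟩
    obtain ⟨V, hV0, hVU, hV⟩ := IsRelOpenOn.exists_sub_subset
      (fun n => (hgen n).isCompact h𝒮) hmono rfl hsub hU hU0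
    exact ⟨⟨V, hV0, hV⟩, hVU⟩
  choose F hF using hstep
  -- Iterated halving from A, so that V 0 = A is itself a basic neighborhood.
  let V : ℕ → {U : Set G // (0 : G) ∈ U ∧ IsRelOpenOn (range C) U} := fun n =>
    Nat.rec ⟨A, hA0, by rintro _ ⟨n, rfl⟩; exact hA _ (hgen n)⟩ (fun _ => F) n
  obtain ⟨t, ht⟩ := exists_addGroupTopology_of_antitone (fun n => (V n).1) (fun n => (V n).2.1)
    (fun n => hF (V n))
  refine ⟨t, ht.isCountablyGenerated, ht.mem_of_mem (i := 0) trivial, ?_⟩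
  rintro _ ⟨n, rfl⟩
  refine ht.tendsto_right_iff.2 fun m _ => ?_
  have h0 : (0 : G) ∈ C (n + 1) := hle n (Or.inr (mem_insert _ _))
  have hlim : Tendsto (u n) atTop (𝓝[C (n + 1)] 0) :=
    tendsto_nhdsWithin_iff.2 ⟨h𝒮 _ (mem_range_self n),
      Eventually.of_forall fun k => hle n (Or.inr (mem_insert_of_mem _ (mem_range_self k)))⟩
  exact hlim ((V m).2.2 _ (mem_range_self (n + 1)) 0 h0 (V m).2.1)

end TopologicalAddGroup

/-! ### Transfinite construction -/

/-- The transfinite construction: along a well-order with countable initial segments, null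
sequences are added and neighborhoods of `0` are fixed alternately. -/
theorem exists_addGroupTopology_of_wellOrder {I G : Type*} [LinearOrder I] [WellFoundedLT I]
    (hI : ∀ i : I, (Iio i).Countable) [AddCommGroup G] [σ : TopologicalSpace G]
    [IsTopologicalAddGroup G] [FirstCountableTopology G]
    (task : I → Set G × (ℕ → Set G)) (htask : Function.Surjective task) (H : AddSubgroup G)
    (𝓑 : Set (ℕ → G)) (h𝓑c : 𝓑.Countable) (h𝓑 : ∀ s ∈ 𝓑, Tendsto s atTop (𝓝 0)) :
    ∃ (t : TopologicalSpace G) (𝒮 : Set (ℕ → G)), @IsTopologicalAddGroup G t _ ∧ t ≤ σ ∧ 𝓑 ⊆ 𝒮 ∧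
      (∀ s ∈ 𝒮, Tendsto s atTop (@nhds G t 0)) ∧
      (∀ s ∈ 𝒮, s ∈ 𝓑 ∨ ∀ n, s n ∈ H) ∧
      (∀ A : Set G, 0 ∈ A → @IsRelOpenOn G σ {K | IsSeqGenerated 𝒮 K} A → A ∈ @nhds G t 0) ∧
      (∀ K : ℕ → Set G, (∀ n, K n ∉ @nhds G t 0 ⊓ 𝓟 (H : Set G)) →
        ∃ s ∈ 𝒮, ∀ n, s n ∉ K n) := by
  let T := {p : (ℕ → G) × AddGroupTopology G // Tendsto p.1 atTop (𝓝 0) ∧ (∀ n, p.1 n ∈ H) ∧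
    (@nhds G p.2.toTopologicalSpace 0).IsCountablyGenerated}
  let seqs : ∀ i : I, (∀ j, j < i → T) → (ℕ → G) → Set (ℕ → G) := fun i g s =>
    insert s (𝓑 ∪ range fun j : Iio i => (g j j.2).1.1)
  let F : ∀ i : I, (∀ j, j < i → T) → Filter G := fun i g =>
    (𝓝 0 ⊓ ⨅ j : Iio i, @nhds G (g j j.2).1.2.toTopologicalSpace 0) ⊓ 𝓟 (H : Set G)
  obtain ⟨f, hf⟩ := exists_forall_of_wellFoundedLT (I := I) (T := T)
    (fun i g x =>
      Tendsto x.1.1 atTop (F i g) ∧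
      ((∀ n, (task i).2 n ∉ F i g) → ∀ n, x.1.1 n ∉ (task i).2 n) ∧
      (∀ s ∈ seqs i g x.1.1, Tendsto s atTop (@nhds G x.1.2.toTopologicalSpace 0)) ∧
      (0 ∈ (task i).1 → IsRelOpenOn {K | IsSeqGenerated (seqs i g x.1.1) K} (task i).1 →
        (task i).1 ∈ @nhds G x.1.2.toTopologicalSpace 0)) (by
    intro i g
    have hcount : Countable (Iio i) := hI i
    have hcg : ∀ j : Iio i,
      (@nhds G (g j j.2).1.2.toTopologicalSpace 0).IsCountablyGenerated := fun j => (g j j.2).2.2.2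
    have hFcg : (F i g).IsCountablyGenerated := by
      dsimp only [F]
      infer_instance
    obtain ⟨s, hs, hsK⟩ : ∃ s : ℕ → G, Tendsto s atTop (F i g) ∧ (∀ n, s n ∈ H) ∧
        ((∀ n, (task i).2 n ∉ F i g) → ∀ n, s n ∉ (task i).2 n) := by
      by_cases hK : ∀ n, (task i).2 n ∉ F i g
      · obtain ⟨s, hs, hsK⟩ := (F i g).exists_seq_tendsto_forall_notMem
          (fun n => (task i).2 n ∪ (H : Set G)ᶜ) fun n hn => hK n (by
            filter_upwards [hn, mem_inf_of_right (mem_principal_self _)] with x hx hxH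
            exact hx.resolve_right fun h => h hxH)
        exact ⟨s, hs, fun n => not_not.1 fun h => hsK n (Or.inr h),
          fun _ n h => hsK n (Or.inl h)⟩
      · refine ⟨fun _ => 0, ?_, fun _ => H.zero_mem, fun h => (hK h).elim⟩
        refine tendsto_inf.2 ⟨tendsto_inf.2 ⟨tendsto_const_nhds, tendsto_iInf.2 fun j => ?_⟩, ?_⟩
        · exact @tendsto_const_nhds G (g j j.2).1.2.toTopologicalSpace ℕ 0 atTop
        · exact tendsto_principal.2 (Eventually.of_forall fun _ => H.zero_mem)
    have hs0 : Tendsto s atTop (𝓝 0) := (tendsto_inf.1 (tendsto_inf.1 hs).1).1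
    have hseqs : ∀ r ∈ seqs i g s, Tendsto r atTop (𝓝 0) := by
      rintro r (rfl | hr | ⟨j, rfl⟩)
      · exact hs0
      · exact h𝓑 r hr
      · exact (g j j.2).2.1
    have hc : (seqs i g s).Countable := (h𝓑c.union (countable_range _)).insert s
    by_cases hA : 0 ∈ (task i).1 ∧ IsRelOpenOn {K | IsSeqGenerated (seqs i g s) K} (task i).1
    · obtain ⟨t, ht, htA, hts⟩ := exists_addGroupTopology_mem_nhds hc (insert_nonempty _ _) hseqs
        hA.1 hA.2
      exact ⟨⟨(s, t), hs0, hsK.1, ht⟩, hs, hsK.2, hts, fun _ _ => htA⟩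
    · obtain ⟨t, ht, -, hts⟩ := exists_addGroupTopology_mem_nhds hc (insert_nonempty _ _) hseqs
        (mem_univ 0) (fun _ _ _ _ _ => univ_mem)
      exact ⟨⟨(s, t), hs0, hsK.1, ht⟩, hs, hsK.2, hts, fun h h' => (hA ⟨h, h'⟩).elim⟩)
  -- The index `none` carries σ, so the common refinement is finer than σ.
  let τ : Option I → AddGroupTopology G := fun o => o.elim ⟨σ, inferInstance⟩ fun i => (f i).1.2
  have hnhds : @nhds G (⨅ o, τ o).toTopologicalSpace 0 =
      ⨅ o, @nhds G (τ o).toTopologicalSpace 0 := by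
    rw [AddGroupTopology.toTopologicalSpace_iInf, nhds_iInf]
  have hle : ∀ o, @nhds G (⨅ o, τ o).toTopologicalSpace 0 ≤ @nhds G (τ o).toTopologicalSpace 0 :=
    fun o => hnhds.trans_le (iInf_le _ o)
  have hmem : ∀ i, ∀ s ∈ seqs i (fun j _ => f j) (f i).1.1,
      s ∈ 𝓑 ∪ range fun i => (f i).1.1 := by
    rintro i s (rfl | hs | ⟨j, rfl⟩)
    · exact Or.inr ⟨i, rfl⟩
    · exact Or.inl hs
    · exact Or.inr ⟨j, rfl⟩
  refine ⟨(⨅ o, τ o).toTopologicalSpace, 𝓑 ∪ range fun i => (f i).1.1,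
    (⨅ o, τ o).toIsTopologicalAddGroup, AddGroupTopology.toTopologicalSpace_le.2 (iInf_le τ none),
    subset_union_left, ?_, ?_, ?_, ?_⟩
  · rintro s hs
    rw [hnhds]
    refine tendsto_iInf.2 ?_
    rintro (_ | i)
    · rcases hs with hs | ⟨j, rfl⟩
      · exact h𝓑 s hs
      · exact (f j).2.1
    · rcases hs with hs | ⟨j, rfl⟩
      · exact (hf i).2.2.1 s (Or.inr (Or.inl hs))
      -- Later sequences were chosen null in earlier topologies; later topologies were built to keep
      -- earlier sequences null.
      · rcases lt_trichotomy i j with h | rfl | h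
        · exact tendsto_iInf.1 (tendsto_inf.1 (tendsto_inf.1 (hf j).1).1).2 ⟨i, h⟩
        · exact (hf i).2.2.1 _ (Or.inl rfl)
        · exact (hf i).2.2.1 _ (Or.inr (Or.inr ⟨⟨j, h⟩, rfl⟩))
  · rintro s (hs | ⟨j, rfl⟩)
    · exact Or.inl hs
    · exact Or.inr (f j).2.2.1
  · intro A hA0 hA
    obtain ⟨i, hi⟩ := htask (A, fun _ => ∅)
    have := (hf i).2.2.2
    rw [hi] at this
    exact hle (some i) (this hA0 fun K hK => hA K (hK.mono (hmem i)))
  · intro K hK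
    obtain ⟨i, hi⟩ := htask (∅, K)
    have := (hf i).2.1
    rw [hi] at this
    refine ⟨(f i).1.1, Or.inr ⟨i, rfl⟩, this fun n hn => hK n ?_⟩
    have hF : @nhds G (⨅ o, τ o).toTopologicalSpace 0 ⊓ 𝓟 (H : Set G) ≤ F i fun j _ => f j :=
      inf_le_inf_right _ (le_inf (hle none) (le_iInf fun j => hle (some j)))
    exact hF hn

/-! ### Sequentiality and failure of k_ω -/

/-- On a generated compact set the topology agrees with the first countable σ, so failure of
relative openness is witnessed by a convergent sequence. -/
theorem sequentialSpace_of_isRelOpenOn {G : Type*} [AddCommGroup G] {σ : TopologicalSpace G}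
    [t : TopologicalSpace G] [IsTopologicalAddGroup G] (hσ : @T2Space G σ)
    (hσc : @FirstCountableTopology G σ) (hle : t ≤ σ) {𝒮 : Set (ℕ → G)}
    (h𝒮 : ∀ s ∈ 𝒮, Tendsto s atTop (𝓝 0))
    (hnhds : ∀ A : Set G, 0 ∈ A → @IsRelOpenOn G σ {K | IsSeqGenerated 𝒮 K} A → A ∈ 𝓝 0) :
    SequentialSpace G := by
  refine ⟨fun B hB => ?_⟩
  rw [← isOpen_compl_iff, isOpen_iff_mem_nhds]
  intro x hx
  rw [← map_add_left_nhds_zero, mem_map]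
  refine hnhds _ (by simpa using hx) ?_
  intro K hK y hyK hy
  by_contra hA
  have hcg : (@nhds G σ y ⊓ 𝓟 K).IsCountablyGenerated := by
    have := hσc.nhds_generated_countable y
    infer_instance
  obtain ⟨s, hs, hsA⟩ := (@nhds G σ y ⊓ 𝓟 K).exists_seq_tendsto_forall_notMem
    (fun _ => (x + ·) ⁻¹' Bᶜ) fun _ => hA
  have hlim : Tendsto s atTop (𝓝 y) :=
    hs.mono_right ((hK.isCompact h𝒮).nhds_inf_principal_le_of_le hσ hle y)
  exact hy (hB (fun n => not_not.1 (hsA n)) (hlim.const_add x))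

theorem not_isKOmegaSpace_of_seq {X : Type*} [TopologicalSpace X] [T1Space X] (a : X)
    (h : ∀ K : ℕ → Set X, (∀ n, IsCompact (K n)) →
      ∃ s : ℕ → X, Tendsto s atTop (𝓝 a) ∧ ∀ n, s n ∉ K n) : ¬ IsKOmegaSpace X := by
  rintro ⟨K, hK, hopen⟩
  -- With partial unions, only finitely many terms of s lie in each K m, so its range would be
  -- closed; inserting a keeps a out of the range.
  obtain ⟨s, hs, hsK⟩ := h (fun n => insert a (⋃ m ∈ Iic n, K m)) fun n =>
    ((finite_Iic n).isCompact_biUnion fun m _ => hK m).insert a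
  have hsa : ∀ n, s n ≠ a := fun n hn => hsK n (Or.inl hn)
  have hO : IsOpen (range s)ᶜ := by
    rw [hopen]
    intro m
    have hfin : (s '' Iio m).Finite := (finite_Iio m).image s
    convert hfin.isClosed.isOpen_compl.preimage (continuous_subtype_val (p := (· ∈ K m))) using 1
    ext ⟨x, hx⟩
    simp only [mem_preimage, mem_compl_iff, not_iff_not]
    refine ⟨?_, fun hx => image_subset_range _ _ hx⟩
    rintro ⟨n, rfl⟩
    refine ⟨n, mem_Iio.2 <| not_le.1 fun hmn => hsK n (Or.inr ?_), rfl⟩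
    exact mem_biUnion (mem_Iic.2 hmn) hx
  have ha : a ∈ (range s)ᶜ := by
    rintro ⟨n, hn⟩
    exact hsa n hn
  obtain ⟨n, hn⟩ := (hs.eventually (hO.mem_nhds ha)).exists
  exact hn (mem_range_self n)

/-- In a countable Hausdorff group, a compact set is not a neighborhood of `0` relative to a
nondiscrete closed subgroup. -/
theorem IsCompact.notMem_nhds_inf_principal {G : Type*} [AddCommGroup G] [Countable G]
    [TopologicalSpace G] [IsTopologicalAddGroup G] [T2Space G] {H : AddSubgroup G}
    (hH : IsClosed (H : Set G)) {h : ℕ → G} (hh : Tendsto h atTop (𝓝 0)) (hhH : ∀ n, h n ∈ H)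
    (hh0 : ∀ n, h n ≠ 0) {K : Set G} (hK : IsCompact K) : K ∉ 𝓝 0 ⊓ 𝓟 (H : Set G) := by
  intro hmem
  have hKH : IsCompact ((↑) ⁻¹' K : Set H) := hH.isClosedEmbedding_subtypeVal.isCompact_preimage hK
  have hnhds : ((↑) ⁻¹' K : Set H) ∈ 𝓝 (0 : H) := by
    rw [nhds_subtype_eq_comap_nhdsWithin]
    exact preimage_mem_comap hmem
  have : LocallyCompactSpace H := hKH.locallyCompactSpace_of_mem_nhds_of_addGroup hnhds
  -- Baire: a countable locally compact Hausdorff group has an isolated point.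
  obtain ⟨x, y, hy⟩ := nonempty_interior_of_iUnion_of_closed (f := fun x : H => ({x} : Set H))
    (fun x => isClosed_singleton) (iUnion_of_singleton H)
  obtain rfl : y = x := (interior_subset : interior {x} ⊆ {x}) hy
  have hdisc : ({0} : Set H) ∈ 𝓝 0 := by
    have h1 : ({y} : Set H) ∈ 𝓝 y := mem_interior_iff_mem_nhds.1 hy
    rw [← map_add_left_nhds_zero, mem_map] at h1
    filter_upwards [h1] with z hz
    simpa using hz
  have hlim : Tendsto (fun n => (⟨h n, hhH n⟩ : H)) atTop (𝓝 0) := tendsto_subtype_rng.2 hh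
  obtain ⟨n, hn⟩ := (hlim.eventually hdisc).exists
  exact hh0 n (congrArg Subtype.val hn)

/-! ### Length functions -/

section Length

variable {G : Type*} [AddCommGroup G] {ℓ : G → ℕ}

theorem IsSeqGenerated.exists_length_le (hsub : ∀ x y, ℓ (x - y) ≤ ℓ x + ℓ y) (h0 : ℓ 0 = 0)
    {𝒮 : Set (ℕ → G)} (h𝒮 : ∀ s ∈ 𝒮, ∃ m, ∀ n, ℓ (s n) ≤ m) {K : Set G}
    (hK : IsSeqGenerated 𝒮 K) : ∃ m, ∀ x ∈ K, ℓ x ≤ m := by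
  induction hK with
  | zero => exact ⟨0, by rintro _ rfl; exact h0.le⟩
  | step K s _ hs ih =>
    obtain ⟨a, ha⟩ := ih
    obtain ⟨b, hb⟩ := h𝒮 s hs
    have key : ∀ x ∈ K ∪ insert 0 (range s), ℓ x ≤ a + b := by
      rintro x (hx | rfl | ⟨n, rfl⟩)
      · exact (ha x hx).trans (Nat.le_add_right _ _)
      · exact h0.trans_le (Nat.zero_le _)
      · exact (hb n).trans (Nat.le_add_left _ _)
    refine ⟨a + b + (a + b), ?_⟩
    rintro _ ⟨x, hx, y, hy, rfl⟩
    exact (hsub x y).trans (Nat.add_le_add (key x hx) (key y hy))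

/-- Terms of unboundedly growing length meet each generated compact set in a finite set, so the
complement of their range is a neighborhood of 0. -/
theorem exists_length_le_of_tendsto (hsub : ∀ x y, ℓ (x - y) ≤ ℓ x + ℓ y) (h0 : ℓ 0 = 0)
    {σ : TopologicalSpace G} [t : TopologicalSpace G] [IsTopologicalAddGroup G]
    (hσ : @T2Space G σ) {𝒮 : Set (ℕ → G)} (h𝒮 : ∀ s ∈ 𝒮, ∃ m, ∀ n, ℓ (s n) ≤ m)
    (hnhds : ∀ A : Set G, 0 ∈ A → @IsRelOpenOn G σ {K | IsSeqGenerated 𝒮 K} A → A ∈ 𝓝 0)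
    {S : ℕ → G} {x : G} (hS : Tendsto S atTop (𝓝 x)) : ∃ m, ∀ n, ℓ (S n) ≤ m := by
  have hadd : ∀ x y, ℓ (x + y) ≤ ℓ x + ℓ y := fun x y => by
    have h1 := hsub x (-y)
    have h2 := hsub 0 y
    rw [sub_neg_eq_add] at h1
    rw [zero_sub] at h2
    omega
  have hlim : Tendsto (fun n => S n - x) atTop (𝓝 0) := by simpa using hS.sub_const x
  suffices ∃ m, ∀ n, ℓ (S n - x) ≤ m by
    obtain ⟨m, hm⟩ := this
    refine ⟨m + ℓ x, fun n => ?_⟩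
    have := hadd (S n - x) x
    rw [sub_add_cancel] at this
    exact this.trans (Nat.add_le_add_right (hm n) _)
  by_contra! hunb
  choose φ hφ using hunb
  have hA : (range fun k => S (φ k) - x)ᶜ ∈ 𝓝 (0 : G) := by
    refine hnhds _ ?_ ?_
    · rintro ⟨k, hk⟩
      have := hφ k
      rw [show S (φ k) - x = 0 from hk, h0] at this
      omega
    · intro K hK y hyK hy
      obtain ⟨m, hm⟩ := hK.exists_length_le hsub h0 h𝒮
      have hfin : ((fun k => S (φ k) - x) '' Iio m).Finite := (finite_Iio m).image _
      have hcl : @IsClosed G σ ((fun k => S (φ k) - x) '' Iio m) :=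
        @Set.Finite.isClosed G σ _ _ hfin
      have hmem : ((fun k => S (φ k) - x) '' Iio m)ᶜ ∈ @nhds G σ y :=
        @IsOpen.mem_nhds G σ y _ (@IsClosed.isOpen_compl G σ _ hcl) fun h =>
          hy (image_subset_range _ _ h)
      refine mem_inf_iff_superset.2 ⟨_, hmem, K, mem_principal_self K, ?_⟩
      rintro z ⟨hz, hzK⟩ ⟨k, rfl⟩
      exact hz ⟨k, (hφ k).trans_le (hm _ hzK), rfl⟩
  obtain ⟨N, hN⟩ := eventually_atTop.1 (hlim.eventually hA)
  -- L bounds the lengths at all indices below N, yet φ L < N has length above L.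
  let L := ∑ m ∈ Finset.range N, ℓ (S m - x)
  have hlt : φ L < N := by
    by_contra hge
    exact hN _ (not_lt.1 hge) ⟨L, rfl⟩
  have : ℓ (S (φ L) - x) ≤ L :=
    Finset.single_le_sum (f := fun m => ℓ (S m - x)) (fun _ _ => Nat.zero_le _)
      (Finset.mem_range.2 hlt)
  exact (hφ L).not_ge this

theorem isNowhereDense_setOf_length_le [t : TopologicalSpace G] [IsTopologicalAddGroup G]
    {e : ℕ → G} (he : Tendsto e atTop (𝓝 0)) (hlt : ∀ x, ∀ᶠ n in atTop, ℓ x < ℓ (x + e n))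
    {n : ℕ} (hcl : IsClosed {x | ℓ x ≤ n}) : IsNowhereDense {x | ℓ x ≤ n} := by
  rw [hcl.isNowhereDense_iff, eq_empty_iff_forall_notMem]
  have hsubset : interior {x | ℓ x ≤ n} ⊆ {x | ℓ x ≤ n} := interior_subset
  -- Induction on the deficit k = n - ℓ x: adding a late e m stays in the interior and lowers k.
  have key : ∀ k x, x ∈ interior {x | ℓ x ≤ n} → k ≤ n → ℓ x ≠ n - k := by
    intro k
    induction k using Nat.strong_induction_on with
    | _ k ih =>
      intro x hx hk hxk
      have hlim : Tendsto (fun m => x + e m) atTop (𝓝 x) := by simpa using he.const_add x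
      obtain ⟨m, hm, hm'⟩ :=
        ((hlim.eventually (isOpen_interior.mem_nhds hx)).and (hlt x)).exists
      have hle : ℓ (x + e m) ≤ n := hsubset hm
      exact ih (n - ℓ (x + e m)) (by omega) _ hm (by omega) (by omega)
  intro x hx
  have hle : ℓ x ≤ n := hsubset hx
  exact key (n - ℓ x) x hx (by omega) (by omega)

end Length

/-- Here h keeps H nondiscrete and e makes the sets ℓ ≤ n nowhere dense. All other added sequences
lie in H, where ℓ = 0. -/
theorem exists_sequential_not_isKOmegaSpace {I G : Type*} [LinearOrder I] [WellFoundedLT I]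
    (hI : ∀ i : I, (Iio i).Countable) [AddCommGroup G] [Countable G] [σ : TopologicalSpace G]
    [IsTopologicalAddGroup G] [T2Space G] [FirstCountableTopology G]
    (task : I → Set G × (ℕ → Set G)) (htask : Function.Surjective task) {ℓ : G → ℕ}
    (hsub : ∀ x y, ℓ (x - y) ≤ ℓ x + ℓ y) (hcl : ∀ n, IsClosed {x | ℓ x ≤ n})
    (H : AddSubgroup G) (hH : ∀ x, x ∈ H ↔ ℓ x = 0)
    {h e : ℕ → G} (hh : Tendsto h atTop (𝓝 0)) (hhH : ∀ n, h n ∈ H) (hh0 : ∀ n, h n ≠ 0)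
    (he : Tendsto e atTop (𝓝 0)) (heℓ : ∀ n, ℓ (e n) ≤ 1)
    (hlt : ∀ x, ∀ᶠ n in atTop, ℓ x < ℓ (x + e n)) :
    ∃ t : TopologicalSpace G, @IsTopologicalAddGroup G t _ ∧ @T3Space G t ∧
      @SequentialSpace G t ∧ ¬ @IsKOmegaSpace G t ∧ (∀ n, @IsNowhereDense G t {x | ℓ x ≤ n}) ∧
      ∀ (S : ℕ → G) (x : G), Tendsto S atTop (@nhds G t x) → ∃ m, ∀ n, ℓ (S n) ≤ m := by
  have h𝓑 : ∀ s ∈ ({h, e} : Set (ℕ → G)), Tendsto s atTop (𝓝 0) := by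
    rintro s (rfl | rfl)
    exacts [hh, he]
  obtain ⟨t, 𝒮, ht, hle, h𝓑𝒮, h𝒮, h𝒮H, hnhds, hK⟩ :=
    exists_addGroupTopology_of_wellOrder hI task htask H {h, e} (to_countable _) h𝓑
  have hσ : @T2Space G σ := inferInstance
  have hσc : @FirstCountableTopology G σ := inferInstance
  have h0 : ℓ 0 = 0 := (hH 0).1 H.zero_mem
  have h𝒮ℓ : ∀ s ∈ 𝒮, ∃ m, ∀ n, ℓ (s n) ≤ m := by
    intro s hs
    refine ⟨1, ?_⟩
    rcases h𝒮H s hs with (rfl | rfl) | hs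
    · exact fun n => ((hH _).1 (hhH n)).trans_le zero_le_one
    · exact heℓ
    · exact fun n => ((hH _).1 (hs n)).trans_le zero_le_one
  have hcl' : ∀ n, @IsClosed G t {x | ℓ x ≤ n} := fun n => (hcl n).mono hle
  have hHcl : @IsClosed G t (H : Set G) := by
    convert hcl' 0 using 1
    ext x
    simp [hH]
  have ht2 : @T2Space G t := t2Space_antitone hle hσ
  let := t
  refine ⟨t, ht, inferInstance, sequentialSpace_of_isRelOpenOn hσ hσc hle h𝒮 hnhds,
    not_isKOmegaSpace_of_seq 0 fun K hKc => ?_, fun n => ?_, fun S x hS => ?_⟩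
  · obtain ⟨s, hs, hsK⟩ := hK K fun n => (hKc n).notMem_nhds_inf_principal hHcl
      (h𝒮 h (h𝓑𝒮 (mem_insert _ _))) hhH hh0
    exact ⟨s, h𝒮 s hs, hsK⟩
  · exact isNowhereDense_setOf_length_le (h𝒮 e (h𝓑𝒮 (mem_insert_of_mem _ rfl))) hlt (hcl' n)
  · exact exists_length_le_of_tendsto hsub h0 hσ h𝒮ℓ hnhds hS

/-! ### The concrete group under CH -/

/-- Under the Continuum Hypothesis, a type of cardinality continuum is enumerated along a
well-order with countable initial segments. -/
theorem exists_wellOrder_surjective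
    (hCH : (Cardinal.aleph 1 : Cardinal.{0}) = Cardinal.continuum.{0}) {T : Type}
    (hT : Cardinal.mk T = Cardinal.continuum) :
    ∃ (I : Type) (_ : LinearOrder I) (_ : WellFoundedLT I) (f : I → T),
      (∀ i : I, (Iio i).Countable) ∧ Function.Surjective f := by
  have hcard : Cardinal.mk (Cardinal.aleph 1).ord.ToType = Cardinal.mk T := by
    rw [Cardinal.mk_toType, Cardinal.card_ord, hT, hCH]
  obtain ⟨f⟩ := Cardinal.eq.1 hcard
  refine ⟨(Cardinal.aleph 1).ord.ToType, inferInstance, inferInstance, f, fun i => ?_, f.surjective⟩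
  rw [← Cardinal.le_aleph0_iff_set_countable, ← Order.lt_succ_iff, Cardinal.succ_aleph0]
  simpa using Cardinal.mk_Iio_lt i (by simp)

theorem tendsto_finsupp_single_coe :
    Tendsto (fun n : ℕ => ⇑(Finsupp.single n (1 : ℤ))) atTop (𝓝 (0 : ℕ → ℤ)) := by
  refine tendsto_pi_nhds.2 fun k => tendsto_const_nhds.congr' ?_
  filter_upwards [eventually_gt_atTop k] with n hn
  rw [Finsupp.single_eq_of_ne hn.ne]
  rfl

theorem mainTheorem12 (hCH : (Cardinal.aleph 1 : Cardinal.{0}) = Cardinal.continuum.{0}) :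
    ∃ (G : Type) (_ : Group G) (_ : TopologicalSpace G),
      IsTopologicalGroup G ∧ T3Space G ∧ Countable G ∧ SequentialSpace G ∧
      ¬ IsKOmegaSpace G ∧
      ∃ Ξ : Set (Set G), Ξ.Countable ∧ (∀ ξ ∈ Ξ, IsNowhereDense ξ) ∧
        ∀ (S : ℕ → G) (x : G), Filter.Tendsto S Filter.atTop (nhds x) →
          ∃ ξ ∈ Ξ, Set.range S ⊆ ξ := by
  let G := (ℕ →₀ ℤ) × (ℕ →₀ ℤ)
  have hT : Cardinal.mk (Set G × (ℕ → Set G)) = Cardinal.continuum := by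
    simp [G]
  obtain ⟨I, _, _, task, hI, htask⟩ := exists_wellOrder_surjective hCH hT
  let φ : G →+ (ℕ → ℤ) × (ℕ → ℤ) := Finsupp.coeFnAddHom.prodMap Finsupp.coeFnAddHom
  have hφ : Function.Injective φ :=
    Function.Injective.prodMap DFunLike.coe_injective DFunLike.coe_injective
  let σ : TopologicalSpace G := .induced φ inferInstance
  have hind : IsInducing φ := ⟨rfl⟩
  have hσg : @IsTopologicalAddGroup G σ _ := topologicalAddGroup_induced φ
  have hσ2 : @T2Space G σ := T2Space.of_injective_continuous hφ hind.continuous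
  have hσc : @FirstCountableTopology G σ := hind.firstCountableTopology
  let ℓ : G → ℕ := fun x => x.2.support.card
  have hsub : ∀ x y, ℓ (x - y) ≤ ℓ x + ℓ y := fun x y =>
    (Finset.card_le_card Finsupp.support_sub).trans (Finset.card_union_le _ _)
  have hcl : ∀ n, @IsClosed G σ {x | ℓ x ≤ n} := by
    intro n
    rw [← isOpen_compl_iff, isOpen_iff_mem_nhds]
    intro x hx
    have hcoord : ∀ k, @Continuous G ℤ σ _ fun y => y.2 k := fun k =>
      (continuous_apply k).comp (continuous_snd.comp hind.continuous)
    have hev : ∀ᶠ y in @nhds G σ x, ∀ k ∈ x.2.support, y.2 k ≠ 0 :=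
      (Filter.eventually_all_finset _).2 fun k hk =>
        (hcoord k).continuousAt.eventually_ne (Finsupp.mem_support_iff.1 hk)
    filter_upwards [hev] with y hy hyn
    refine hx (le_trans (Finset.card_le_card fun k hk => ?_) hyn)
    exact Finsupp.mem_support_iff.2 (hy k hk)
  have hlim : ∀ s : ℕ → G, Tendsto (φ ∘ s) atTop (𝓝 0) → Tendsto s atTop (@nhds G σ 0) :=
    fun s hs => hind.tendsto_nhds_iff.2 (by rwa [map_zero])
  obtain ⟨t, htg, ht3, hseq, hk, hnd, hS⟩ := exists_sequential_not_isKOmegaSpace hI task htask hsub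
    hcl (AddMonoidHom.snd (ℕ →₀ ℤ) (ℕ →₀ ℤ)).ker (fun x => AddMonoidHom.mem_ker.trans
      (Finset.card_eq_zero.trans Finsupp.support_eq_empty).symm)
    (h := fun n => (Finsupp.single n 1, 0)) (e := fun n => (0, Finsupp.single n 1))
    (hlim _ (tendsto_finsupp_single_coe.prodMk_nhds tendsto_const_nhds))
    (fun n => AddMonoidHom.mem_ker.2 rfl)
    (fun n hn => one_ne_zero (Finsupp.single_eq_zero.1 (congrArg Prod.fst hn)))
    (hlim _ (tendsto_const_nhds.prodMk_nhds tendsto_finsupp_single_coe))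
    (fun n => (Finset.card_le_card Finsupp.support_single_subset).trans_eq (Finset.card_singleton n))
    (fun x => by
      filter_upwards [(Filter.eventually_all_finset x.2.support).2 fun k _ =>
        eventually_ne_atTop k] with n hn
      have hxn : n ∉ x.2.support := fun h => hn n h rfl
      refine Finset.card_lt_card ⟨fun k hk => ?_, fun h => hxn (h ?_)⟩
      · rw [Finsupp.mem_support_iff] at hk ⊢
        change x.2 k + Finsupp.single n 1 k ≠ 0
        rwa [Finsupp.single_eq_of_ne (hn k (Finsupp.mem_support_iff.2 hk)).symm, add_zero]
      · rw [Finsupp.mem_support_iff]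
        change x.2 n + Finsupp.single n 1 n ≠ 0
        simp [Finsupp.notMem_support_iff.1 hxn])
  refine ⟨Multiplicative G, inferInstance, t, ?_, ht3, inferInstanceAs (Countable G), hseq, hk,
    range fun n => {x : G | ℓ x ≤ n}, countable_range _, ?_, ?_⟩
  · exact inferInstanceAs (IsTopologicalGroup (Multiplicative G))
  · rintro _ ⟨n, rfl⟩
    exact hnd n
  · intro S x hSx
    obtain ⟨m, hm⟩ := hS S x hSx
    refine ⟨_, ⟨m, rfl⟩, ?_⟩
    rintro _ ⟨n, rfl⟩
    exact hm n
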